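/- Let $H(\mathbb C)$ be the space of entire functions with the topology of uniform convergence on compact sets, and let $N: H(\mathbb C)\times H(\mathbb C)\to H(\mathbb C)$ be the continuous bilinear operator $N(f,g)=g(0)\,f'$. For a continuous bilinear operator $M:X\times X\to X$ and initial conditions $(x_{-1},x_0)\in X\times X$, define $x_n=M(x_{n-2},x_{n-1})$ for $n\ge 1$, and write $M^n(x_{-1},x_0)=x_n$ for $n\geq 1$. The operator $M$ is called hypercyclic if for some $(x_{-1},x_0)$ the orbit $\{x_n : n\ge -1\}$ is dense in $X$, and strongly transitive if for all nonempty open sets $U\subseteq X\times X$ and $V\subseteq X$ there is $n\ge 1$ with $M^n(U)\cap V\neq\emptyset$. Then $N$ is hypercyclic and not strongly transitive. -/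

import Mathlib

open Topology

/-- The space `H(ℂ)` of entire functions, as a subspace of `C(ℂ, ℂ)`. It carries the subspace
topology of the compact-open topology, that is, uniform convergence on compact sets. -/
abbrev EntireFun : Submodule ℂ C(ℂ, ℂ) where
  carrier := {f | Differentiable ℂ (f : ℂ → ℂ)}
  add_mem' {f g} hf hg := by
    have : Differentiable ℂ (fun z => f z + g z) := Differentiable.fun_add hf hg
    exact this
  zero_mem' := by
    have : Differentiable ℂ (fun _ : ℂ => (0 : ℂ)) := differentiable_const 0
    exact this
  smul_mem' c f hf := by
    have : Differentiable ℂ (fun z => c • f z) := Differentiable.fun_const_smul hf c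
    exact this

/-- The complex derivative of an entire function, as an entire function. -/
noncomputable def EntireFun.derivFun (f : EntireFun) : EntireFun :=
  have h : Differentiable ℂ (deriv (f.1 : ℂ → ℂ)) :=
    fun z => ((f.2 : Differentiable ℂ (f.1 : ℂ → ℂ)).analyticAt z).deriv.differentiableAt
  ⟨⟨deriv (f.1 : ℂ → ℂ), h.continuous⟩, h⟩

theorem EntireFun.derivFun_apply (f : EntireFun) (z : ℂ) :
    (EntireFun.derivFun f).1 z = deriv (f.1 : ℂ → ℂ) z := rfl

theorem EntireFun.continuous_derivFun : Continuous EntireFun.derivFun := by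
  rw [continuous_iff_continuousAt]
  intro f
  rw [ContinuousAt, tendsto_subtype_rng, ContinuousMap.tendsto_iff_tendstoLocallyUniformly,
    ← tendstoLocallyUniformlyOn_univ]
  have h : Filter.Tendsto (fun g : EntireFun => g.1) (𝓝 f) (𝓝 f.1) :=
    continuous_subtype_val.tendsto f
  rw [ContinuousMap.tendsto_iff_tendstoLocallyUniformly, ← tendstoLocallyUniformlyOn_univ] at h
  exact h.deriv (Filter.Eventually.of_forall fun g => g.2.differentiableOn) isOpen_univ

/-- The derivation operator `D f = f'` on `H(ℂ)`. -/
noncomputable def EntireFun.D : EntireFun →L[ℂ] EntireFun where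
  toFun := EntireFun.derivFun
  map_add' f g := by
    ext z
    exact deriv_add (f.2 z) (g.2 z)
  map_smul' c f := by
    ext z
    exact deriv_const_smul c (f.2 z)
  cont := EntireFun.continuous_derivFun

/-- The continuous bilinear operator `N(f, g) = g(0) D(f)` on `H(ℂ)`. -/
noncomputable def EntireFun.N : ContinuousMultilinearMap ℂ (fun _ : Fin 2 => EntireFun) EntireFun where
  toFun v := (v 1).1 0 • EntireFun.D (v 0)
  map_update_add' v i x y := by
    fin_cases i
    · simp
    · simp [add_smul]
  map_update_smul' v i c x := by
    fin_cases i
    · simp [smul_smul, mul_comm]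
    · simp [mul_smul]
  cont := by
    have h1 : Continuous fun v : Fin 2 → EntireFun => (v 1).1 0 :=
      (continuous_eval_const (0 : ℂ)).comp
        (continuous_subtype_val.comp (continuous_apply 1))
    exact h1.smul (EntireFun.D.continuous.comp (continuous_apply 0))

theorem EntireFun.N_apply (f g : EntireFun) (z : ℂ) :
    (EntireFun.N ![f, g]).1 z = g.1 0 * deriv (f.1 : ℂ → ℂ) z := rfl

section Dynamics

variable {X : Type*} [AddCommMonoid X] [Module ℂ X] [TopologicalSpace X]

/-- The sequence generated by a bilinear operator `M` from the initial conditions `x₋₁ = x`,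
`x₀ = y` through `xₙ = M(xₙ₋₂, xₙ₋₁)`. The index is shifted by one: `orbitSeq M x y k = xₖ₋₁`,
so that the `n`-th iterate `Mⁿ(x, y)`, `n ≥ 1`, is `orbitSeq M x y (n + 1)`. -/
def orbitSeq (M : ContinuousMultilinearMap ℂ (fun _ : Fin 2 => X) X) (x y : X) : ℕ → X
  | 0 => x
  | 1 => y
  | n + 2 => M ![orbitSeq M x y n, orbitSeq M x y (n + 1)]

/-- `(x, y)` is a hypercyclic vector for `M`: the orbit `{xₙ : n ≥ -1}` is dense in `X`. -/
def IsHypercyclicVector (M : ContinuousMultilinearMap ℂ (fun _ : Fin 2 => X) X)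
    (x y : X) : Prop :=
  Dense (Set.range (orbitSeq M x y))

/-- `M` is hypercyclic: it has a hypercyclic vector. -/
def IsHypercyclic (M : ContinuousMultilinearMap ℂ (fun _ : Fin 2 => X) X) : Prop :=
  ∃ x y : X, IsHypercyclicVector M x y

/-- A family of maps `F i : A → B` is transitive if for all nonempty open `U ⊆ A`, `V ⊆ B` there
is an index `i` such that `F i (U)` meets `V`. -/
def IsTransitiveFamily {ι A B : Type*} [TopologicalSpace A] [TopologicalSpace B]
    (F : ι → A → B) : Prop :=
  ∀ (U : Set A) (V : Set B), IsOpen U → U.Nonempty → IsOpen V → V.Nonempty →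
    ∃ i, (F i '' U ∩ V).Nonempty

/-- `M` is strongly transitive: the family of its iterates `Mⁿ : X × X → X`, `n ≥ 1`, is
transitive. (The index `n : ℕ` below stands for the iterate `Mⁿ⁺¹`.) -/
def IsStronglyTransitive (M : ContinuousMultilinearMap ℂ (fun _ : Fin 2 => X) X) : Prop :=
  IsTransitiveFamily fun (n : ℕ) (p : X × X) => orbitSeq M p.1 p.2 (n + 2)

end Dynamics

/-! Along an orbit from `(f, g)`, the even-indexed terms of `orbitSeq` are multiples of `D^[k] f`
and the odd-indexed ones of `D^[k] g`. If `f` and `g` are small on the unit disc, Cauchy's estimates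
make the scalar factors decay factorially, so the values at 0 never leave the disc of radius 1/2
(`norm_orbitSeq_apply_zero_le`); this excludes strong transitivity.

For hypercyclicity, let `aₖ = f⁽ᵏ⁾(0)`, all nonzero. Taking `g⁽ᵏ⁾(0) = 1/(a₁⋯aₖ)` cancels the
scalars, and the even terms are exactly `D^[k] f` (`exists_orbitSeq_two_mul_eq`). It remains to find
`f` with dense `D`-orbit for which `aₖ` and `1/(a₀⋯aₖ₋₁)` grow at most geometrically. The `aₖ` are
blocks of derivatives of approximants to a dense sequence, padded with ones (`exists_coeff_approx`,
`exists_concat`). -/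

namespace EntireFun

/-! ### Derivatives at the origin -/

/-- The `n`-th derivative of an entire function at the origin. -/
noncomputable def derivAtZero (f : EntireFun) (n : ℕ) : ℂ := (D^[n] f).1 0

theorem coe_D (f : EntireFun) : ((D f).1 : ℂ → ℂ) = deriv f.1 := rfl

theorem coe_iterate_D (f : EntireFun) (n : ℕ) :
    ((D^[n] f).1 : ℂ → ℂ) = iteratedDeriv n f.1 := by
  induction n with
  | zero => simp
  | succ n ih => rw [Function.iterate_succ_apply', coe_D, ih, iteratedDeriv_succ]

theorem derivAtZero_eq_iteratedDeriv (f : EntireFun) (n : ℕ) :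
    derivAtZero f n = iteratedDeriv n f.1 0 := by
  rw [derivAtZero, coe_iterate_D]

theorem derivAtZero_iterate_D (f : EntireFun) (m n : ℕ) :
    derivAtZero (D^[m] f) n = derivAtZero f (m + n) := by
  rw [derivAtZero, derivAtZero, ← Function.iterate_add_apply, add_comm]

theorem hasSum_derivAtZero (f : EntireFun) (z : ℂ) :
    HasSum (fun n : ℕ => derivAtZero f n * z ^ n / n.factorial) (f.1 z) := by
  have h := Complex.hasSum_taylorSeries_of_entire (f := f.1) f.2 0 z
  convert! h using 2 with n
  rw [derivAtZero_eq_iteratedDeriv, sub_zero, smul_eq_mul, smul_eq_mul]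
  ring

theorem summable_norm_derivAtZero (f : EntireFun) (R : ℝ) :
    Summable fun n : ℕ => ‖derivAtZero f n‖ * |R| ^ n / n.factorial := by
  have h := (hasSum_derivAtZero f (R : ℂ)).summable.norm
  simpa using h

/-- A sequence of at most geometric growth is the sequence of derivatives at the origin of an
entire function. -/
theorem exists_derivAtZero_eq (a : ℕ → ℂ) (C r : ℝ) (ha : ∀ n, ‖a n‖ ≤ C * r ^ n) :
    ∃ f : EntireFun, ∀ n, derivAtZero f n = a n := by
  let p := FormalMultilinearSeries.ofScalars ℂ fun n => a n / (n.factorial : ℂ)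
  have hp : p.radius = ⊤ := by
    refine p.radius_eq_top_of_summable_norm fun s => ?_
    have hs := (Real.summable_pow_div_factorial (r * s)).mul_left C
    refine Summable.of_nonneg_of_le (fun n => by positivity) (fun n => ?_) hs
    rw [FormalMultilinearSeries.norm_apply_eq_norm_coef,
      FormalMultilinearSeries.coeff_ofScalars, norm_div, Complex.norm_natCast, mul_pow,
      div_mul_eq_mul_div, mul_div_assoc', ← mul_assoc]
    gcongr
    exact ha n
  have hball : HasFPowerSeriesOnBall p.sum p 0 ⊤ := by
    simpa only [hp] using p.hasFPowerSeriesOnBall (by simp [hp])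
  have hd : Differentiable ℂ p.sum := fun z =>
    (hball.analyticAt_of_mem (by simp)).differentiableAt
  refine ⟨⟨⟨p.sum, hd.continuous⟩, hd⟩, fun n => ?_⟩
  -- Uniqueness of the power series identifies the coefficients of `p` with the Taylor coefficients
  -- of its sum.
  have hc := congrArg (fun q => FormalMultilinearSeries.coeff q n)
    (hball.hasFPowerSeriesAt.eq_formalMultilinearSeries
      (hball.hasFPowerSeriesAt.analyticAt.hasFPowerSeriesAt))
  simp only [p, FormalMultilinearSeries.coeff_ofScalars] at hc
  rw [derivAtZero_eq_iteratedDeriv]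
  exact ((div_left_inj' (Nat.cast_ne_zero.2 n.factorial_ne_zero)).1 hc).symm

/-! ### Failure of strong transitivity -/

theorem N_apply_eq (f g : EntireFun) : N ![f, g] = g.1 0 • D f := rfl

/-- If every `|f⁽ⁿ⁾(0)|` and `|g⁽ⁿ⁾(0)|` is at most `n! / 2`, the orbit stays small at the origin. -/
theorem norm_orbitSeq_apply_zero_le (f g : EntireFun)
    (hf : ∀ n, ‖derivAtZero f n‖ ≤ n.factorial / 2)
    (hg : ∀ n, ‖derivAtZero g n‖ ≤ n.factorial / 2) (n : ℕ) :
    ‖(orbitSeq N f g n).1 0‖ ≤ 1 / 2 := by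
  -- The bound `1/(k+1)!` closes the induction because `k + 2 ≤ 2(k + 1)`; the weaker `1/k!` would
  -- not.
  have key : ∀ k : ℕ, ∃ c d : ℂ, ‖c‖ ≤ 1 / (k + 1).factorial ∧ ‖d‖ ≤ 1 / (k + 1).factorial ∧
      orbitSeq N f g (2 * k) = c • D^[k] f ∧ orbitSeq N f g (2 * k + 1) = d • D^[k] g := by
    intro k
    induction k with
    | zero => exact ⟨1, 1, by simp, by simp, by simp [orbitSeq], by simp [orbitSeq]⟩
    | succ k ih =>
      obtain ⟨c, d, hc, hd, hx, hy⟩ := ih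
      have h1 : orbitSeq N f g (2 * (k + 1)) = (d * derivAtZero g k * c) • D^[k + 1] f := by
        change N ![orbitSeq N f g (2 * k), orbitSeq N f g (2 * k + 1)] = _
        rw [hx, hy, N_apply_eq, map_smul, smul_smul, ← Function.iterate_succ_apply' (f := D)]
        rfl
      have h2 : orbitSeq N f g (2 * (k + 1) + 1) =
          (d * derivAtZero g k * c * derivAtZero f (k + 1) * d) • D^[k + 1] g := by
        change N ![orbitSeq N f g (2 * k + 1), orbitSeq N f g (2 * (k + 1))] = _
        rw [h1, hy, N_apply_eq, map_smul, smul_smul, ← Function.iterate_succ_apply' (f := D)]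
        rfl
      have hk : (0 : ℝ) < k.factorial := by positivity
      have hc' : ‖d * derivAtZero g k * c‖ ≤ 1 / (k + 1 + 1).factorial := by
        rw [norm_mul, norm_mul]
        calc ‖d‖ * ‖derivAtZero g k‖ * ‖c‖
            ≤ 1 / (k + 1).factorial * (k.factorial / 2) * (1 / (k + 1).factorial) := by
              gcongr
              exact hg k
          _ ≤ 1 / (k + 1 + 1).factorial := by
              rw [Nat.factorial_succ (k + 1), Nat.factorial_succ k]
              push_cast
              have hk1 : (0 : ℝ) < k + 1 := by positivity
              have hk2 : (0 : ℝ) < k + 1 + 1 := by positivity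
              rw [show 1 / (((k : ℝ) + 1) * k.factorial) * (k.factorial / 2) *
                (1 / ((k + 1) * k.factorial)) = 1 / (2 * (k + 1) * ((k + 1) * k.factorial)) by
                  field_simp]
              gcongr
              linarith
      refine ⟨_, _, hc', ?_, h1, h2⟩
      rw [norm_mul, norm_mul]
      calc ‖d * derivAtZero g k * c‖ * ‖derivAtZero f (k + 1)‖ * ‖d‖
          ≤ 1 / (k + 1 + 1).factorial * ((k + 1).factorial / 2) * (1 / (k + 1).factorial) := by
            gcongr
            exact hf (k + 1)
        _ = 1 / (k + 1 + 1).factorial / 2 := by field_simp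
        _ ≤ 1 / (k + 1 + 1).factorial := half_le_self (by positivity)
  have small : ∀ (h : EntireFun) (k : ℕ) (c : ℂ), ‖derivAtZero h k‖ ≤ k.factorial / 2 →
      ‖c‖ ≤ 1 / (k + 1).factorial → ‖(c • D^[k] h).1 0‖ ≤ 1 / 2 := by
    intro h k c hh hc
    change ‖c * derivAtZero h k‖ ≤ 1 / 2
    rw [norm_mul]
    calc ‖c‖ * ‖derivAtZero h k‖ ≤ 1 / k.factorial * (k.factorial / 2) := by
          gcongr
          refine hc.trans ?_
          gcongr
          exact k.le_succ
      _ = 1 / 2 := by field_simp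
  obtain ⟨k, rfl | rfl⟩ := n.even_or_odd'
  · obtain ⟨c, d, hc, -, hx, -⟩ := key k
    rw [hx]
    exact small f k c (hf k) hc
  · obtain ⟨c, d, -, hd, -, hy⟩ := key k
    rw [hy]
    exact small g k d (hg k) hd

/-- The entire functions of modulus less than `1 / 2` on the closed unit disc. -/
def smallOnDisc : Set EntireFun :=
  {f | Set.MapsTo f.1 (Metric.closedBall 0 1) (Metric.ball 0 (1 / 2))}

theorem isOpen_smallOnDisc : IsOpen smallOnDisc :=
  (ContinuousMap.isOpen_setOfPred_mapsTo (isCompact_closedBall (0 : ℂ) 1)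
    (Metric.isOpen_ball (x := (0 : ℂ)) (ε := 1 / 2))).preimage continuous_subtype_val

/-- Cauchy's estimate on the unit circle. -/
theorem norm_derivAtZero_le {f : EntireFun} (hf : f ∈ smallOnDisc) (n : ℕ) :
    ‖derivAtZero f n‖ ≤ n.factorial / 2 := by
  have hfd : Differentiable ℂ f.1 := f.2
  have h := Complex.norm_iteratedDeriv_le_of_forall_mem_sphere_norm_le (c := 0) (R := 1)
    (C := 1 / 2) n one_pos hfd.diffContOnCl
    (fun z hz => (mem_ball_zero_iff.1 (hf (Metric.sphere_subset_closedBall hz))).le)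
  rw [derivAtZero_eq_iteratedDeriv]
  simpa [div_eq_mul_inv] using h

theorem not_isStronglyTransitive_N : ¬ IsStronglyTransitive N := by
  intro h
  have hV : IsOpen {f : EntireFun | 1 < ‖f.1 0‖} :=
    isOpen_lt continuous_const
      ((continuous_eval_const (0 : ℂ)).comp continuous_subtype_val).norm
  have h0 : (0 : EntireFun) ∈ smallOnDisc := fun z _ => by simp
  obtain ⟨n, y, ⟨p, ⟨hp1, hp2⟩, rfl⟩, hy⟩ :=
    h (smallOnDisc ×ˢ smallOnDisc) {f : EntireFun | 1 < ‖f.1 0‖}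
    (isOpen_smallOnDisc.prod isOpen_smallOnDisc) ⟨(0, 0), h0, h0⟩ hV
    ⟨⟨ContinuousMap.const ℂ 2, differentiable_const (2 : ℂ)⟩, by simp⟩
  have := norm_orbitSeq_apply_zero_le p.1 p.2 (norm_derivAtZero_le hp1)
    (norm_derivAtZero_le hp2) (n + 2)
  have hy' : 1 < ‖(orbitSeq N p.1 p.2 (n + 2)).1 0‖ := hy
  linarith

end EntireFun

/-! ### Reduction to the orbit of one function under differentiation -/

namespace EntireFun

/-- If `f` has geometrically bounded, nonzero derivatives at the origin `aₖ`, a suitable second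
initial condition makes the even part of the orbit of `N` the orbit of `f` under `D`. -/
theorem exists_orbitSeq_two_mul_eq (f : EntireFun) (hf : ∀ n, derivAtZero f n ≠ 0) (C : ℝ)
    (hC : ∀ n, ‖∏ i ∈ Finset.range n, derivAtZero f i‖⁻¹ ≤ C * 2 ^ n) :
    ∃ g : EntireFun, ∀ k, orbitSeq N f g (2 * k) = D^[k] f := by
  set a := derivAtZero f with ha
  let P : ℕ → ℂ := fun k => ∏ i ∈ Finset.range k, a (i + 1)
  have hP : ∀ k, P k ≠ 0 := fun k => Finset.prod_ne_zero_iff.2 fun i _ => hf _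
  -- Since `a₀ P n` is the product of the first `n + 1` terms, `1/|P n| ≤ |a₀| C 2ⁿ⁺¹`.
  obtain ⟨g, hg⟩ := exists_derivAtZero_eq (fun k => (P k)⁻¹) (‖a 0‖ * (C * 2)) 2 fun n => by
    have h := hC (n + 1)
    rw [Finset.prod_range_succ', norm_mul, mul_inv, ← div_eq_mul_inv,
      div_le_iff₀ (norm_pos_iff.2 (hf 0))] at h
    rw [norm_inv]
    refine h.trans_eq ?_
    ring
  refine ⟨g, fun k => ?_⟩
  suffices orbitSeq N f g (2 * k) = D^[k] f ∧ orbitSeq N f g (2 * k + 1) = P k • D^[k] g from this.1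
  induction k with
  | zero => simp [orbitSeq, P]
  | succ k ih =>
    have h1 : orbitSeq N f g (2 * (k + 1)) = D^[k + 1] f := by
      change N ![orbitSeq N f g (2 * k), orbitSeq N f g (2 * k + 1)] = _
      rw [ih.1, ih.2, N_apply_eq, ← Function.iterate_succ_apply' (f := D)]
      change (P k * derivAtZero g k) • _ = _
      rw [hg, mul_inv_cancel₀ (hP k), one_smul]
    refine ⟨h1, ?_⟩
    change N ![orbitSeq N f g (2 * k + 1), orbitSeq N f g (2 * (k + 1))] = _
    rw [h1, ih.2, N_apply_eq, map_smul, smul_smul, ← Function.iterate_succ_apply' (f := D)]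
    change (a (k + 1) * P k) • _ = _
    rw [mul_comm, ← Finset.prod_range_succ]

/-- Approximation of an entire function on a disc through its derivatives at the origin: finitely
many derivatives, all of them nonzero, are prescribed, and the others need only be at most
geometric. -/
theorem exists_coeff_approx (h : EntireFun) (R ε : ℝ) (hR : 0 ≤ R) (hε : 0 < ε) :
    ∃ (L : ℕ) (b : ℕ → ℂ), (∀ j, b j ≠ 0) ∧ (∀ j, L ≤ j → b j = 1) ∧
      ∀ φ : EntireFun, (∀ j < L, derivAtZero φ j = b j) →
        (∀ j, L ≤ j → ‖derivAtZero φ j‖ ≤ 2 ^ j) →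
        ∀ z : ℂ, ‖z‖ ≤ R → ‖φ.1 z - h.1 z‖ ≤ ε := by
  -- Majorant of the `j`-th term of `φ - h` on the disc once `|φ⁽ʲ⁾(0)| ≤ 2ʲ`; `L` makes its tail
  -- less than `ε/2`.
  let v : ℕ → ℝ := fun j => (2 ^ j + ‖derivAtZero h j‖) * R ^ j / j.factorial
  have hv : Summable v := by
    have h1 := Real.summable_pow_div_factorial (2 * R)
    have h2 := summable_norm_derivAtZero h R
    rw [abs_of_nonneg hR] at h2
    refine (h1.add h2).congr fun j => ?_
    simp only [v]
    ring
  have hlim : Filter.Tendsto (fun L => ∑' j, v j - ∑ j ∈ Finset.range L, v j) Filter.atTop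
      (𝓝 0) := by
    simpa using hv.hasSum.tendsto_sum_nat.const_sub (∑' j, v j)
  obtain ⟨L, hL⟩ := (hlim.eventually (gt_mem_nhds (half_pos hε))).exists
  let E : ℝ := ∑' j : ℕ, R ^ j / j.factorial
  have hE : HasSum (fun j : ℕ => R ^ j / j.factorial) E := (Real.summable_pow_div_factorial R).hasSum
  have hE0 : 0 ≤ E := hE.nonneg fun j => by positivity
  -- Replacing the vanishing derivatives of `h` by `δ` costs at most `δ E ≤ ε/2`.
  let δ : ℝ := ε / (2 * (E + 1))
  have hδ : 0 < δ := by positivity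
  have hδE : δ * E ≤ ε / 2 := by
    simp only [δ]
    rw [div_mul_eq_mul_div, div_le_div_iff₀ (by positivity) (by positivity)]
    nlinarith
  refine ⟨L, fun j => if j < L then (if derivAtZero h j = 0 then (δ : ℂ) else derivAtZero h j)
    else 1, fun j => ?_, fun j hj => by simp [not_lt.2 hj], fun φ h1 h2 z hz => ?_⟩
  · have : (δ : ℂ) ≠ 0 := by exact_mod_cast hδ.ne'
    dsimp only
    split_ifs <;> simp_all
  have hs := (hasSum_derivAtZero φ z).sub (hasSum_derivAtZero h z)
  have hfin : HasSum (fun j => if j < L then v j else 0) (∑ j ∈ Finset.range L, v j) := by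
    have : HasSum (fun j => if j < L then v j else 0)
        (∑ j ∈ Finset.range L, if j < L then v j else 0) :=
      hasSum_sum_of_ne_finset_zero fun j hj => if_neg (by simpa using hj)
    rwa [Finset.sum_congr rfl fun j hj => if_pos (Finset.mem_range.1 hj)] at this
  refine (hs.norm_le_of_bounded ((hE.mul_left δ).add (hv.hasSum.sub hfin)) fun j => ?_).trans
    (by linarith)
  have hz' : ‖z‖ ^ j / j.factorial ≤ R ^ j / j.factorial := by gcongr
  have hn : ‖derivAtZero φ j * z ^ j / j.factorial - derivAtZero h j * z ^ j / j.factorial‖ =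
      ‖derivAtZero φ j - derivAtZero h j‖ * (‖z‖ ^ j / j.factorial) := by
    rw [← sub_div, ← sub_mul, norm_div, norm_mul, norm_pow, Complex.norm_natCast, mul_div_assoc]
  rw [hn]
  refine (mul_le_mul_of_nonneg_left hz' (norm_nonneg _)).trans ?_
  have hRj : 0 ≤ R ^ j / j.factorial := by positivity
  by_cases hj : j < L
  · rw [if_pos hj, sub_self, add_zero]
    refine mul_le_mul_of_nonneg_right ?_ hRj
    rw [h1 j hj]
    dsimp only
    rw [if_pos hj]
    split_ifs with h0
    · simp [h0, abs_of_pos hδ]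
    · simpa using hδ.le
  · rw [if_neg hj, sub_zero]
    refine le_add_of_nonneg_of_le (by positivity) ?_
    simp only [v]
    rw [mul_div_assoc]
    refine mul_le_mul_of_nonneg_right ?_ hRj
    exact (norm_sub_le _ _).trans (by gcongr; exact h2 j (not_lt.1 hj))

end EntireFun

/-! ### Concatenation of blocks -/

/-- A nonvanishing sequence that is eventually `1` is bounded, and so are the inverses of its
partial products. -/
theorem exists_bound_of_eventually_one (b : ℕ → ℂ) (L : ℕ) (hL : ∀ j, L ≤ j → b j = 1) :
    ∃ C : ℝ, ∀ j, ‖b j‖ ≤ C ∧ ‖∏ i ∈ Finset.range j, b i‖⁻¹ ≤ C := by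
  have h1 : Filter.Tendsto (fun j => ‖b j‖) Filter.atTop (𝓝 1) :=
    tendsto_const_nhds.congr' (Filter.eventually_atTop.2 ⟨L, fun j hj => by simp [hL j hj]⟩)
  have h2 : Filter.Tendsto (fun j => ‖∏ i ∈ Finset.range j, b i‖⁻¹) Filter.atTop
      (𝓝 ‖∏ i ∈ Finset.range L, b i‖⁻¹) := by
    refine tendsto_const_nhds.congr' (Filter.eventually_atTop.2 ⟨L, fun j hj => ?_⟩)
    rw [Finset.prod_subset (Finset.range_mono hj)
      fun i _ hi => hL i (by simpa using hi)]
  obtain ⟨C, hC⟩ := h1.bddAbove_range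
  obtain ⟨K, hK⟩ := h2.bddAbove_range
  exact ⟨max C K, fun j => ⟨(hC ⟨j, rfl⟩).trans (le_max_left _ _),
    (hK ⟨j, rfl⟩).trans (le_max_right _ _)⟩⟩

/-- Concatenation of blocks: the first `N m` terms of the sequences `B m` are put one after the
other. If the blocks are long enough compared with the bounds of the following block, the growth
of the resulting sequence is controlled, and so are the inverses of its partial products. -/
theorem exists_concat (B : ℕ → ℕ → ℂ) (C : ℕ → ℝ) (N : ℕ → ℕ) (hB0 : ∀ m j, B m j ≠ 0)
    (hB : ∀ m j, ‖B m j‖ ≤ C m) (hP : ∀ m j, ‖∏ i ∈ Finset.range j, B m i‖⁻¹ ≤ C m)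
    (hN : ∀ m, 0 < N m) (hC : ∀ m, C (m + 1) ≤ 2 ^ N m) :
    ∃ (a : ℕ → ℂ) (n : ℕ → ℕ), (∀ k, a k ≠ 0) ∧ (∀ k, ‖a k‖ ≤ C 0 * 2 ^ k) ∧
      (∀ k, ‖∏ i ∈ Finset.range k, a i‖⁻¹ ≤ C 0 * 2 ^ k) ∧
      (∀ m, ∀ j < N m, a (n m + j) = B m j) ∧
      ∀ m j, N m ≤ j → ‖a (n m + j)‖ ≤ 2 ^ j := by
  let n : ℕ → ℕ := fun m => ∑ i ∈ Finset.range m, N i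
  have hn : ∀ m, n (m + 1) = n m + N m := fun m => Finset.sum_range_succ _ _
  have hmono : StrictMono n := strictMono_nat_of_lt_succ fun m => by
    rw [hn]
    exact Nat.lt_add_of_pos_right (hN m)
  -- The block containing position `k`; block `m` starts at `n m`. Searching up to `k` suffices
  -- since `m ≤ n m`.
  let idx : ℕ → ℕ := fun k => Nat.findGreatest (fun m => n m ≤ k) k
  have hidx : ∀ m, ∀ j < N m, idx (n m + j) = m := fun m j hj => by
    rw [Nat.findGreatest_eq_iff]
    refine ⟨(hmono.le_apply (x := m)).trans (Nat.le_add_right _ _),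
      fun _ => Nat.le_add_right _ _, fun p hp _ hle => ?_⟩
    have := hmono.monotone (Nat.succ_le_of_lt hp)
    rw [Nat.succ_eq_add_one, hn] at this
    omega
  have hex : ∀ k, ∃ m, ∃ j < N m, k = n m + j := fun k => by
    refine ⟨idx k, k - n (idx k), ?_, ?_⟩
    · by_contra hlt
      have h2 : n (idx k + 1) ≤ k := by
        rw [hn]
        have : n (idx k) ≤ k := Nat.findGreatest_spec (P := fun m => n m ≤ k) (m := 0)
          (Nat.zero_le k) (by simp [n])
        omega
      have h3 := Nat.le_findGreatest (P := fun m => n m ≤ k) ((hmono.le_apply).trans h2) h2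
      exact absurd h3 (Nat.not_succ_le_self _)
    · have : n (idx k) ≤ k := Nat.findGreatest_spec (P := fun m => n m ≤ k) (m := 0)
        (Nat.zero_le k) (by simp [n])
      omega
  let a : ℕ → ℂ := fun k => B (idx k) (k - n (idx k))
  have ha : ∀ m, ∀ j < N m, a (n m + j) = B m j := fun m j hj => by
    simp only [a]
    rw [hidx m j hj, Nat.add_sub_cancel_left]
  have hC1 : ∀ m, 1 ≤ C m := fun m => by simpa using hP m 0
  have hfar : ∀ m j, N m ≤ j → ‖a (n m + j)‖ ≤ 2 ^ j := fun m j hj => by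
    obtain ⟨p, i, hi, hp⟩ := hex (n m + j)
    rw [hp, ha p i hi]
    have hmp : m < p := by
      by_contra hle
      have := hmono.monotone (Nat.succ_le_succ (not_lt.1 hle))
      rw [Nat.succ_eq_add_one, Nat.succ_eq_add_one, hn, hn] at this
      omega
    obtain ⟨q, rfl⟩ := Nat.exists_eq_succ_of_ne_zero (Nat.ne_zero_of_lt hmp)
    -- Block `q` lies wholly between positions `n m` and `n m + j`, so `N q ≤ j`.
    refine (hB _ _).trans ((hC q).trans (pow_le_pow_right₀ one_le_two ?_))
    have := hmono.monotone (Nat.le_of_lt_succ hmp)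
    have h1 := hn q
    rw [Nat.succ_eq_add_one] at hp
    omega
  have hblock : ∀ m, ∀ j ≤ N m, ∏ i ∈ Finset.range (n m + j), a i =
      (∏ i ∈ Finset.range (n m), a i) * ∏ i ∈ Finset.range j, B m i := fun m j hj => by
    rw [Finset.prod_range_add]
    congr 1
    exact Finset.prod_congr rfl fun i hi =>
      ha m i ((Finset.mem_range.1 hi).trans_le hj)
  -- The factor `C m` reserves room for the partial products inside block `m`; the length of block
  -- `m` pays for `C (m + 1)`.
  have hbd : ∀ m, ‖∏ i ∈ Finset.range (n m), a i‖⁻¹ * C m ≤ C 0 * 2 ^ n m := by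
    intro m
    induction m with
    | zero => simp [n]
    | succ m ih =>
      rw [hn, hblock m _ le_rfl, norm_mul, mul_inv, pow_add, ← mul_assoc (C 0)]
      refine mul_le_mul (le_trans ?_ ih) (hC m) (zero_le_one.trans (hC1 _)) ?_
      · exact mul_le_mul_of_nonneg_left (hP m _) (by positivity)
      · exact mul_nonneg (zero_le_one.trans (hC1 0)) (by positivity)
  refine ⟨a, n, fun k => hB0 _ _, fun k => ?_, fun k => ?_, ha, hfar⟩
  · have hk : (1 : ℝ) ≤ 2 ^ k := one_le_pow₀ one_le_two
    have hn0 : n 0 = 0 := by simp [n]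
    by_cases hlt : k < N 0
    · have := ha 0 k hlt
      rw [hn0, zero_add] at this
      rw [this]
      exact (hB 0 k).trans (le_mul_of_one_le_right (zero_le_one.trans (hC1 0)) hk)
    · have := hfar 0 k (not_lt.1 hlt)
      rw [hn0, zero_add] at this
      exact this.trans (le_mul_of_one_le_left (by positivity) (hC1 0))
  · obtain ⟨m, j, hj, rfl⟩ := hex k
    rw [hblock m j hj.le, norm_mul, mul_inv]
    refine (mul_le_mul_of_nonneg_left (hP m j) (by positivity)).trans ((hbd m).trans ?_)
    refine mul_le_mul_of_nonneg_left ?_ (zero_le_one.trans (hC1 0))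
    exact pow_le_pow_right₀ one_le_two (Nat.le_add_right _ _)

/-! ### Hypercyclicity -/

namespace EntireFun

/-- A compact set lies in the disc of radius `t` for all large `t`. -/
theorem tendsto_of_norm_sub_le {u : ℕ → EntireFun} {f : EntireFun}
    (h : ∀ t : ℕ, ∀ z : ℂ, ‖z‖ ≤ t → ‖(u t).1 z - f.1 z‖ ≤ 1 / ((t : ℝ) + 1)) :
    Filter.Tendsto u Filter.atTop (𝓝 f) := by
  rw [tendsto_subtype_rng, ContinuousMap.tendsto_iff_forall_isCompact_tendstoUniformlyOn]
  intro K hK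
  rw [Metric.tendstoUniformlyOn_iff]
  intro ε hε
  obtain ⟨R, hR⟩ := hK.isBounded.exists_norm_le
  filter_upwards [tendsto_one_div_add_atTop_nhds_zero_nat.eventually (gt_mem_nhds hε),
    Filter.eventually_ge_atTop ⌈R⌉₊] with t ht1 ht2 z hz
  rw [dist_comm, dist_eq_norm]
  exact (h t z ((hR z hz).trans (Nat.ceil_le.1 ht2))).trans_lt ht1

theorem isHypercyclic_N : IsHypercyclic N := by
  have : SecondCountableTopology EntireFun :=
    TopologicalSpace.Subtype.secondCountableTopology _
  let u := TopologicalSpace.denseSeq EntireFun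
  -- Unpairing `m` assigns infinitely many blocks to each `u i`, with radii tending to infinity and
  -- errors to zero.
  choose L B hB0 hB1 hBapp using fun m : ℕ => exists_coeff_approx (u m.unpair.1) m
    (1 / ((m : ℝ) + 1)) m.cast_nonneg (by positivity)
  choose C hC using fun m => exists_bound_of_eventually_one (B m) (L m) (hB1 m)
  choose s hs using fun m => pow_unbounded_of_one_lt (C (m + 1)) one_lt_two
  -- `L m` keeps all prescribed derivatives, `s m` absorbs the bound `C (m + 1)`, and `1` makes the
  -- length positive.
  let N' : ℕ → ℕ := fun m => L m + s m + 1
  obtain ⟨a, n, ha0, haC, haP, haB, hafar⟩ := exists_concat B C N' hB0 (fun m j => (hC m j).1)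
    (fun m j => (hC m j).2) (fun m => Nat.succ_pos _)
    (fun m => (hs m).le.trans (pow_le_pow_right₀ one_le_two (by simp only [N']; omega)))
  obtain ⟨f, hf⟩ := exists_derivAtZero_eq a (C 0) 2 haC
  obtain ⟨g, hg⟩ := exists_orbitSeq_two_mul_eq f (fun k => by rw [hf]; exact ha0 k) (C 0)
    (fun k => by simpa only [hf] using haP k)
  have happ : ∀ m : ℕ, ∀ z : ℂ, ‖z‖ ≤ m →
      ‖(D^[n m] f).1 z - (u m.unpair.1).1 z‖ ≤ 1 / ((m : ℝ) + 1) := by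
    intro m
    refine hBapp m _ (fun j hj => ?_) fun j hj => ?_
    · rw [derivAtZero_iterate_D, hf, haB m j (by simp only [N']; omega)]
    · rw [derivAtZero_iterate_D, hf]
      -- Positions from `L m` to the end of the block hold padding ones; later blocks are controlled
      -- by `hafar`.
      by_cases hlt : j < N' m
      · rw [haB m j hlt, hB1 m j hj, norm_one]
        exact one_le_pow₀ one_le_two
      · exact hafar m j (not_lt.1 hlt)
  refine ⟨f, g, ?_⟩
  refine dense_closure.1 ((TopologicalSpace.denseRange_denseSeq EntireFun).mono ?_)
  rintro _ ⟨i, rfl⟩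
  have hlim : Filter.Tendsto (fun t => D^[n (Nat.pair i t)] f) Filter.atTop (𝓝 (u i)) := by
    refine tendsto_of_norm_sub_le fun t z hz => ?_
    have ht : (t : ℝ) ≤ (Nat.pair i t : ℕ) := Nat.cast_le.2 (Nat.right_le_pair i t)
    have h := happ (Nat.pair i t) z (hz.trans ht)
    rw [Nat.unpair_pair] at h
    exact h.trans (by gcongr)
  exact mem_closure_of_tendsto hlim (Filter.Eventually.of_forall fun t => ⟨_, hg _⟩)

end EntireFun

theorem mainTheorem8 :
    IsHypercyclic EntireFun.N ∧ ¬ IsStronglyTransitive EntireFun.N :=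
  ⟨EntireFun.isHypercyclic_N, EntireFun.not_isStronglyTransitive_N⟩
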